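/- Let $m$ be an infinite cardinal. All homomorphisms of profinite groups are understood to be continuous, and finite groups carry the discrete topology. A profinite group $\Pi$ is called quasi-free of rank $m$ if for every pair of epimorphisms $(\alpha:\Pi\to G,\ f:\Gamma\to G)$ with $\Gamma$ a finite group, $\ker f\neq 1$, and such that $f$ admits a splitting (a homomorphism $s:G\to\Gamma$ with $f\circ s=\mathrm{id}_G$), there are exactly $m$ epimorphisms $\beta:\Pi\to\Gamma$ with $f\circ\beta=\alpha$. Theorem. If $\Pi$ is a profinite group that is quasi-free of rank $m$, then its commutator subgroup $\Pi'$, i.e. the closure in $\Pi$ of the subgroup generated by all commutators, is also quasi-free of rank $m$. -/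

import Mathlib

universe u

/-- The proper solutions of the embedding problem `(α : Π → G, f : Γ → G)`: the continuous
surjective homomorphisms `β : Π → Γ` with `f ∘ β = α`. -/
def ProperSolution {P : Type u} {G Γ : Type}
    [Group P] [TopologicalSpace P] [Group G] [TopologicalSpace G] [Group Γ] [TopologicalSpace Γ]
    (α : P →ₜ* G) (f : Γ →ₜ* G) : Type u :=
  {β : P →ₜ* Γ // f.comp β = α ∧ Function.Surjective β}

/-- `P` is quasi-free of rank `m`: every non-trivial finite split embedding problem
`(α : P → G, f : Γ → G)` has exactly `m` proper solutions. Finite groups carry the discrete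
topology; up to isomorphism all of them live in `Type`, and `G` is finite as an image of `Γ`. -/
def IsQuasiFreeOfRank (P : Type u) [Group P] [TopologicalSpace P] (m : Cardinal.{u}) : Prop :=
  ∀ (G Γ : Type) [Group G] [TopologicalSpace G] [DiscreteTopology G]
    [Group Γ] [TopologicalSpace Γ] [DiscreteTopology Γ] [Finite Γ]
    (α : P →ₜ* G) (f : Γ →ₜ* G),
    Function.Surjective α →
    Function.Surjective f →
    (∃ s : G →ₜ* Γ, f.comp s = ContinuousMonoidHom.id G) →
    f.toMonoidHom.ker ≠ ⊥ →
    Cardinal.mk (ProperSolution α f) = m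

/-! Write `T` for the closed commutator subgroup of `P`. At most `m` solutions: a homomorphism with
open kernel on `T` factors, as a map of sets, through a finite symmetric image of `P`, and
quasi-freeness allows only `m` homomorphisms from `P` to each finite group.

At least `m` solutions: an embedding problem `(α, f)` for `T` with splitting `s` is induced to `P`
by a twisted wreath product. Take a finite quotient `ψ₀ : P → Q = R × C₆` such that `α` is trivial
on elements of `T` with trivial `R`-component; the abelian factor `C₆` kills `T`. A
translation-invariant group `K` of `T`-equivariant functions `Q → ker f` gives a split problem `K ⋊
Q → Q` with exactly `m` proper solutions. Restricting such a solution to `T` and evaluating at `1`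
solves `(α, f)` (`IsTwisted.restrict`); surjectivity comes from commutators in `P`, which lie in
`T`.

Restriction is finite-to-one under a centralizer condition on `K` (`IsTwisted.eq_of_restrict_eq`).
If `ker f` has trivial center, all twisted functions work. If `ker f` is abelian, functions
invariant under the generator `g` of `C₆` are an obstruction; imposing `g² - g + 1 = 0` removes
them, because `1 - g = -g²` is then invertible whatever the order of `ker f`. If the center is
nontrivial, one solution is multiplied by the many maps into the center given by the abelian case.
-/

open scoped commutatorElement

/-! ### Continuous homomorphisms as homomorphisms with open kernel -/

/-- A homomorphism with open kernel into a discrete group, as a continuous homomorphism. -/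
def MonoidHom.toContinuousOfOpenKer {P H : Type*} [Group P] [TopologicalSpace P]
    [IsTopologicalGroup P] [Group H] [TopologicalSpace H] [DiscreteTopology H]
    (β : P →* H) (hβ : IsOpen (β.ker : Set P)) : P →ₜ* H where
  toMonoidHom := β
  continuous_toFun := by
    refine continuous_of_continuousAt_one β ?_
    rw [ContinuousAt, map_one, nhds_discrete H, Filter.tendsto_pure]
    exact hβ.mem_nhds (one_mem β.ker)

theorem ContinuousMonoidHom.isOpen_ker {P H : Type*} [Group P] [TopologicalSpace P]
    [Group H] [TopologicalSpace H] [DiscreteTopology H] (β : P →ₜ* H) :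
    IsOpen (β.toMonoidHom.ker : Set P) :=
  (isOpen_discrete ({1} : Set H)).preimage β.continuous_toFun

/-- The proper solutions of an embedding problem for groups without topology on the finite
side: continuity is replaced by openness of the kernel. -/
def OpenSolution {P : Type u} {G Γ : Type} [Group P] [TopologicalSpace P] [Group G] [Group Γ]
    (α : P →* G) (f : Γ →* G) : Type u :=
  {β : P →* Γ // IsOpen (β.ker : Set P) ∧ f.comp β = α ∧ Function.Surjective β}

def properSolutionEquiv {P : Type u} {G Γ : Type} [Group P] [TopologicalSpace P]
    [IsTopologicalGroup P] [Group G] [TopologicalSpace G] [Group Γ] [TopologicalSpace Γ]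
    [DiscreteTopology Γ] (α : P →ₜ* G) (f : Γ →ₜ* G) :
    ProperSolution α f ≃ OpenSolution α.toMonoidHom f.toMonoidHom where
  toFun β := ⟨β.1.toMonoidHom, β.1.isOpen_ker,
    congrArg ContinuousMonoidHom.toMonoidHom β.2.1, β.2.2⟩
  invFun β := ⟨β.1.toContinuousOfOpenKer β.2.1,
    ContinuousMonoidHom.ext fun x => DFunLike.congr_fun β.2.2.1 x, β.2.2.2⟩
  left_inv _ := rfl
  right_inv _ := rfl

/-- This frees all auxiliary finite groups below from carrying a topology. Surjectivity of `f`
follows from the section. -/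
theorem isQuasiFreeOfRank_iff {P : Type u} [Group P] [TopologicalSpace P] [IsTopologicalGroup P]
    {m : Cardinal.{u}} :
    IsQuasiFreeOfRank P m ↔ ∀ (G Γ : Type) [Group G] [Group Γ] [Finite Γ]
      (α : P →* G) (f : Γ →* G) (s : G →* Γ), IsOpen (α.ker : Set P) → Function.Surjective α →
      f.comp s = MonoidHom.id G → f.ker ≠ ⊥ → Cardinal.mk (OpenSolution α f) = m := by
  constructor
  · intro h G Γ _ _ _ α f s hα hα' hs hf
    let _ : TopologicalSpace G := ⊥
    have : DiscreteTopology G := ⟨rfl⟩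
    let _ : TopologicalSpace Γ := ⊥
    have : DiscreteTopology Γ := ⟨rfl⟩
    let f' : Γ →ₜ* G := ⟨f, continuous_of_discreteTopology⟩
    let s' : G →ₜ* Γ := ⟨s, continuous_of_discreteTopology⟩
    have := h G Γ (α.toContinuousOfOpenKer hα) f' hα'
      (fun g => ⟨s g, DFunLike.congr_fun hs g⟩)
      ⟨s', ContinuousMonoidHom.ext fun x => DFunLike.congr_fun hs x⟩ hf
    rw [← this]
    exact (Cardinal.mk_congr (properSolutionEquiv (α.toContinuousOfOpenKer hα) f')).symm
  · rintro h G Γ _ _ _ _ _ _ _ α f hα - ⟨s, hs⟩ hf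
    rw [Cardinal.mk_congr (properSolutionEquiv α f)]
    exact h G Γ α.toMonoidHom f.toMonoidHom s.toMonoidHom α.isOpen_ker hα
      (congrArg ContinuousMonoidHom.toMonoidHom hs) hf

/-! ### The upper bound -/

/-- Every open normal subgroup of a compact group is the kernel of a homomorphism to a finite
symmetric group. -/
theorem exists_perm_hom_ker_eq {P : Type*} [Group P] [TopologicalSpace P] [IsTopologicalGroup P]
    [CompactSpace P] (D : OpenNormalSubgroup P) :
    ∃ (n : ℕ) (θ : P →* Equiv.Perm (Fin n)), θ.ker = D.toSubgroup := by
  have : Finite (P ⧸ D.toSubgroup) := Subgroup.quotient_finite_of_isOpen _ D.isOpen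
  obtain ⟨n, ⟨e⟩⟩ := Finite.exists_equiv_fin (P ⧸ D.toSubgroup)
  refine ⟨n, (e.permCongrHom.toMonoidHom.comp (MulAction.toPermHom _ _)).comp
    (QuotientGroup.mk' D.toSubgroup), ?_⟩
  ext x
  rw [MonoidHom.mem_ker, MonoidHom.comp_apply, map_eq_one_iff, ← MonoidHom.mem_ker,
    QuotientGroup.ker_mk']
  exact e.permCongrHom.injective.comp MulAction.toPerm_injective

/-- A homomorphism with open kernel on a subgroup of a profinite group factors, as a map, through
a finite symmetric quotient of the whole group. -/
theorem exists_perm_hom_ker_le {P : Type*} [Group P] [TopologicalSpace P] [IsTopologicalGroup P]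
    [CompactSpace P] [TotallyDisconnectedSpace P] {Γ : Type*} [Group Γ] (T : Subgroup P)
    (β : T →* Γ) (hβ : IsOpen (β.ker : Set T)) :
    ∃ (n : ℕ) (θ : P →* Equiv.Perm (Fin n)), IsOpen (θ.ker : Set P) ∧
      ∀ t : T, θ t = 1 → β t = 1 := by
  obtain ⟨U, hU, hUβ⟩ := isOpen_induced_iff.1 hβ
  have h1 : (1 : P) ∈ U := by
    have : (1 : T) ∈ Subtype.val ⁻¹' U := hUβ ▸ one_mem β.ker
    exact this
  obtain ⟨D, hD⟩ := ProfiniteGrp.exist_openNormalSubgroup_sub_open_nhds_of_one hU h1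
  obtain ⟨n, θ, hθ⟩ := exists_perm_hom_ker_eq D
  refine ⟨n, θ, hθ ▸ D.isOpen', fun t ht => ?_⟩
  have : t ∈ Subtype.val ⁻¹' U := hD (show (t : P) ∈ D.toSubgroup from hθ ▸ ht)
  rw [hUβ] at this
  exact this

/-- The homomorphisms with open kernel from `P` to `H`. -/
def OpenHom (P : Type u) [Group P] [TopologicalSpace P] (H : Type) [Group H] : Type u :=
  {θ : P →* H // IsOpen (θ.ker : Set P)}

/-- A homomorphism is an epimorphism onto its range, and there are finitely many ranges; each is
counted by an embedding problem over the trivial group. -/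
theorem mk_openHom_le {m : Cardinal.{u}} (hm : Cardinal.aleph0 ≤ m)
    {P : Type u} [Group P] [TopologicalSpace P] [IsTopologicalGroup P]
    (hP : IsQuasiFreeOfRank P m) (H : Type) [Group H] [Finite H] :
    Cardinal.mk (OpenHom P H) ≤ m := by
  rw [isQuasiFreeOfRank_iff] at hP
  let F : OpenHom P H → Σ R : Subgroup H, OpenSolution (1 : P →* Unit) (1 : R →* Unit) :=
    fun θ => ⟨θ.1.range, θ.1.rangeRestrict, by rw [MonoidHom.ker_rangeRestrict]; exact θ.2,
      MonoidHom.ext fun _ => rfl, θ.1.rangeRestrict_surjective⟩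
  let F' : (Σ R : Subgroup H, OpenSolution (1 : P →* Unit) (1 : R →* Unit)) → P →* H :=
    fun x => x.1.subtype.comp x.2.1
  have hF : Function.Injective F := fun a b hab => Subtype.ext (congrArg F' hab)
  have hR : ∀ R : Subgroup H,
      Cardinal.mk (OpenSolution (1 : P →* Unit) (1 : R →* Unit)) ≤ m := by
    intro R
    -- Quasi-freeness says nothing when `R` is trivial, but then there is at most one homomorphism.
    by_cases h : (1 : R →* Unit).ker = ⊥
    · have h1 : ∀ a : R, a = 1 := fun a => by
        rw [← Subgroup.mem_bot, ← h]
        rfl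
      have : Subsingleton (OpenSolution (1 : P →* Unit) (1 : R →* Unit)) :=
        ⟨fun a b => Subtype.ext (MonoidHom.ext fun x => by rw [h1 (a.1 x), h1 (b.1 x)])⟩
      exact (Cardinal.le_one_iff_subsingleton.2 this).trans (Cardinal.one_le_aleph0.trans hm)
    · exact (hP Unit R 1 1 1 (by simp [MonoidHom.ker_one]) (fun _ => ⟨1, rfl⟩)
        (MonoidHom.ext fun _ => rfl) h).le
  refine (Cardinal.mk_le_of_injective hF).trans ?_
  rw [Cardinal.mk_sigma]
  refine (Cardinal.sum_le_lift_mk_mul_iSup _).trans ?_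
  refine Cardinal.mul_le_of_le hm ?_ (ciSup_le' hR)
  exact (Cardinal.lift_lt_aleph0.2 (Cardinal.lt_aleph0_of_finite _)).le.trans hm

/-- A solution is encoded by a homomorphism from `P` to one of countably many symmetric groups,
together with one of finitely many functions from that group to `Γ`. -/
theorem mk_openSolution_le {m : Cardinal.{u}} (hm : Cardinal.aleph0 ≤ m)
    {P : Type u} [Group P] [TopologicalSpace P] [IsTopologicalGroup P]
    [CompactSpace P] [TotallyDisconnectedSpace P] (hP : IsQuasiFreeOfRank P m) (T : Subgroup P)
    {G Γ : Type} [Group G] [Group Γ] [Finite Γ] (α : T →* G) (f : Γ →* G) :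
    Cardinal.mk (OpenSolution α f) ≤ m := by
  let D := Σ n : ℕ, OpenHom P (Equiv.Perm (Fin n)) × (Equiv.Perm (Fin n) → Γ)
  let F : D → T → Γ := fun d t => d.2.2 (d.2.1.1 t)
  have hF : ∀ β : OpenSolution α f, ∃ d : D, F d = β.1 := by
    intro β
    obtain ⟨n, θ, hθ, hθβ⟩ := exists_perm_hom_ker_le T β.1 β.2.1
    classical
    -- The function need not be multiplicative; its value `1` outside `θ(T)` is arbitrary.
    refine ⟨⟨n, ⟨θ, hθ⟩, fun p => if h : ∃ t : T, θ t = p then β.1 h.choose else 1⟩, ?_⟩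
    funext t
    have h : ∃ t' : T, θ t' = θ t := ⟨t, rfl⟩
    have h1 : (if h : ∃ t' : T, θ t' = θ t then β.1 h.choose else 1) = β.1 t := by
      rw [dif_pos h, ← mul_inv_eq_one, ← map_inv, ← map_mul]
      apply hθβ
      simp [h.choose_spec]
    exact h1
  choose d hd using hF
  have hinj : Function.Injective d := fun a b hab =>
    Subtype.ext (DFunLike.coe_injective (by rw [← hd a, ← hd b, hab]))
  refine (Cardinal.mk_le_of_injective hinj).trans ?_
  rw [Cardinal.mk_sigma]
  refine (Cardinal.sum_le_lift_mk_mul_iSup _).trans ?_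
  refine Cardinal.mul_le_of_le hm (by simpa using hm) (ciSup_le' fun n => ?_)
  rw [Cardinal.mk_prod]
  refine Cardinal.mul_le_of_le hm (by simpa using mk_openHom_le hm hP _) ?_
  exact (Cardinal.lift_lt_aleph0.2 (Cardinal.lt_aleph0_of_finite _)).le.trans hm

/-! ### Twisted wreath products and restriction to `T` -/

/-- The left translation action of `Q` on functions `Q → Γ`. -/
def leftTranslate (Q Γ : Type) [Group Q] [Group Γ] : Q →* MulAut (Q → Γ) where
  toFun τ :=
    { toFun := fun φ σ => φ (τ⁻¹ * σ)
      invFun := fun φ σ => φ (τ * σ)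
      left_inv := fun φ => by funext σ; simp
      right_inv := fun φ => by funext σ; simp
      map_mul' := fun _ _ => rfl }
  map_one' := by ext φ σ; simp
  map_mul' τ τ' := by ext φ σ; simp [mul_assoc]

@[simp]
theorem leftTranslate_apply {Q Γ : Type} [Group Q] [Group Γ] (τ : Q) (φ : Q → Γ) (σ : Q) :
    leftTranslate Q Γ τ φ σ = φ (τ⁻¹ * σ) := rfl

/-- The regular wreath product. -/
abbrev RegularWreath (Q Γ : Type) [Group Q] [Group Γ] : Type := (Q → Γ) ⋊[leftTranslate Q Γ] Q

instance {Q Γ : Type} [Group Q] [Group Γ] [Finite Q] [Finite Γ] : Finite (RegularWreath Q Γ) :=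
  Finite.of_equiv _ SemidirectProduct.equivProd.symm

/-- A translation invariant subgroup of functions `Q → Γ` extended by `Q`. -/
def wreathOf {Q Γ : Type} [Group Q] [Group Γ] (K : Subgroup (Q → Γ))
    (hK : ∀ τ, ∀ φ ∈ K, leftTranslate Q Γ τ φ ∈ K) : Subgroup (RegularWreath Q Γ) where
  carrier := {w | w.left ∈ K}
  mul_mem' ha hb := K.mul_mem ha (hK _ _ hb)
  one_mem' := K.one_mem
  inv_mem' ha := hK _ _ (K.inv_mem ha)

/-- A translation invariant group `K` of functions `Q → ker f` that are equivariant with respect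
to the subgroup `T` of `P`, acting on `ker f` through `s ∘ α`. -/
structure IsTwisted {P : Type u} {Q G Γ : Type} [Group P] [Group Q] [Group G] [Group Γ]
    {T : Subgroup P} (ψ₀ : P →* Q) (α : T →* G) (f : Γ →* G) (s : G →* Γ)
    (K : Subgroup (Q → Γ)) : Prop where
  translate_mem : ∀ τ, ∀ φ ∈ K, leftTranslate Q Γ τ φ ∈ K
  map_eq_one : ∀ φ ∈ K, ∀ σ, f (φ σ) = 1
  apply_mul : ∀ φ ∈ K, ∀ (σ : Q) (t : T), φ (σ * ψ₀ t) = (s (α t))⁻¹ * φ σ * s (α t)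

namespace IsTwisted

variable {P : Type u} {Q G Γ : Type} [Group P] [Group Q] [Group G] [Group Γ] {T : Subgroup P}
  {ψ₀ : P →* Q} {α : T →* G} {f : Γ →* G} {s : G →* Γ} {K : Subgroup (Q → Γ)}

/-- The projection of the twisted wreath product onto `Q`. -/
def proj (h : IsTwisted ψ₀ α f s K) : wreathOf K h.translate_mem →* Q :=
  SemidirectProduct.rightHom.comp (wreathOf K h.translate_mem).subtype

def sect (h : IsTwisted ψ₀ α f s K) : Q →* wreathOf K h.translate_mem :=
  SemidirectProduct.inr.codRestrict _ fun _ => K.one_mem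

theorem proj_comp_sect (h : IsTwisted ψ₀ α f s K) : h.proj.comp h.sect = MonoidHom.id Q := rfl

def fiber (h : IsTwisted ψ₀ α f s K) (φ : Q → Γ) (hφ : φ ∈ K) : wreathOf K h.translate_mem :=
  ⟨SemidirectProduct.inl φ, hφ⟩

theorem coe_commutator_fiber_sect (h : IsTwisted ψ₀ α f s K) {φ : Q → Γ} (hφ : φ ∈ K) (τ : Q) :
    (⁅h.fiber φ hφ, h.sect τ⁆ : wreathOf K h.translate_mem).1 =
      SemidirectProduct.inl (φ * (leftTranslate Q Γ τ φ)⁻¹) := by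
  have h1 : (⁅h.fiber φ hφ, h.sect τ⁆ : wreathOf K h.translate_mem).1 =
      SemidirectProduct.inl φ * SemidirectProduct.inr τ * (SemidirectProduct.inl φ)⁻¹ *
        (SemidirectProduct.inr τ)⁻¹ := rfl
  rw [h1]
  ext <;> simp

theorem ker_proj_ne_bot (h : IsTwisted ψ₀ α f s K) {φ : Q → Γ} (hφ : φ ∈ K) (hφ1 : φ ≠ 1) :
    h.proj.ker ≠ ⊥ := by
  intro hb
  have : h.fiber φ hφ ∈ h.proj.ker := rfl
  rw [hb, Subgroup.mem_bot] at this
  exact hφ1 (congrArg (fun w => w.1.left) this)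

variable (h : IsTwisted ψ₀ α f s K)

theorem right_apply {ψ : P →* wreathOf K h.translate_mem} (hψ : h.proj.comp ψ = ψ₀) (x : P) :
    (ψ x).1.right = ψ₀ x := DFunLike.congr_fun hψ x

/-- The homomorphism on `T` obtained from a lift of `ψ₀` to the twisted wreath product by
evaluation at `1`. -/
def restrict (ψ : P →* wreathOf K h.translate_mem) (hψ : h.proj.comp ψ = ψ₀) : T →* Γ where
  toFun t := (ψ t).1.left 1 * s (α t)
  map_one' := by simp
  map_mul' t t' := by
    -- The action of `ψ₀ t` moves the evaluation point of the second factor from `1` to `(ψ₀ t)⁻¹`;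
    -- equivariance turns this shift into conjugation by `s (α t)`.
    have h1 := h.apply_mul _ (ψ t').2 ((ψ₀ t)⁻¹) t
    have h2 : (ψ t').1.left (ψ₀ t)⁻¹ = s (α t) * (ψ t').1.left 1 * (s (α t))⁻¹ := by
      rw [inv_mul_cancel] at h1
      rw [h1]
      group
    simp only [Subgroup.coe_mul, map_mul, SemidirectProduct.mul_left, Pi.mul_apply,
      leftTranslate_apply, h.right_apply hψ, mul_one, h2]
    group

theorem restrict_apply (ψ : P →* wreathOf K h.translate_mem) (hψ : h.proj.comp ψ = ψ₀) (t : T) :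
    h.restrict ψ hψ t = (ψ t).1.left 1 * s (α t) := rfl

theorem comp_restrict (hs : f.comp s = MonoidHom.id G) (ψ : P →* wreathOf K h.translate_mem)
    (hψ : h.proj.comp ψ = ψ₀) : f.comp (h.restrict ψ hψ) = α := by
  ext t
  have := DFunLike.congr_fun hs (α t)
  simp only [MonoidHom.comp_apply, MonoidHom.id_apply] at this
  simp [restrict_apply, h.map_eq_one _ (ψ t).2, this]

theorem isOpen_ker_restrict [TopologicalSpace P] [IsTopologicalGroup P]
    (hα : IsOpen (α.ker : Set T)) (ψ : P →* wreathOf K h.translate_mem)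
    (hψ : h.proj.comp ψ = ψ₀) (hψo : IsOpen (ψ.ker : Set P)) :
    IsOpen ((h.restrict ψ hψ).ker : Set T) := by
  refine Subgroup.isOpen_mono (H₁ := α.ker ⊓ ψ.ker.subgroupOf T) ?_
    (hα.inter (hψo.preimage continuous_subtype_val))
  rintro t ⟨h1, h2⟩
  have h1' : α t = 1 := h1
  have h2' : ψ t = 1 := h2
  simp [MonoidHom.mem_ker, restrict_apply, h1', h2']

/-- The restriction is surjective if the kernel of `f` consists of values at `1` of commutators. -/
theorem surjective_restrict (hT : commutator P ≤ T) (hs : f.comp s = MonoidHom.id G)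
    (hα : Function.Surjective α) (hker : ∀ t : T, ψ₀ t = 1 → α t = 1)
    (hK : ∀ n ∈ f.ker, ∃ φ ∈ K, ∃ τ, φ 1 * (φ τ⁻¹)⁻¹ = n)
    (ψ : P →* wreathOf K h.translate_mem) (hψ : h.proj.comp ψ = ψ₀)
    (hψs : Function.Surjective ψ) : Function.Surjective (h.restrict ψ hψ) := by
  have hN : ∀ n ∈ f.ker, n ∈ (h.restrict ψ hψ).range := by
    intro n hn
    obtain ⟨φ, hφ, τ, rfl⟩ := hK n hn
    obtain ⟨x, hx⟩ := hψs (h.fiber φ hφ)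
    obtain ⟨y, hy⟩ := hψs (h.sect τ)
    have hxy : ⁅x, y⁆ ∈ T := hT (Subgroup.commutator_mem_commutator (Subgroup.mem_top _) (Subgroup.mem_top _))
    have hψxy : (ψ ⁅x, y⁆).1 = SemidirectProduct.inl (φ * (leftTranslate Q Γ τ φ)⁻¹) := by
      rw [map_commutatorElement, hx, hy, coe_commutator_fiber_sect]
    refine ⟨⟨⁅x, y⁆, hxy⟩, ?_⟩
    have h1 : α ⟨⁅x, y⁆, hxy⟩ = 1 := by
      apply hker
      rw [← h.right_apply hψ, hψxy, SemidirectProduct.right_inl]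
    rw [restrict_apply, h1, map_one, mul_one, hψxy]
    simp
  intro γ
  obtain ⟨t, ht⟩ := hα (f γ)
  have h1 : f (h.restrict ψ hψ t) = f γ := by
    rw [← ht]
    exact DFunLike.congr_fun (h.comp_restrict hs ψ hψ) t
  have h2 : γ * (h.restrict ψ hψ t)⁻¹ ∈ f.ker := by
    rw [MonoidHom.mem_ker, map_mul, map_inv, h1, mul_inv_cancel]
  obtain ⟨t', ht'⟩ := hN _ h2
  exact ⟨t' * t, by rw [map_mul, ht', inv_mul_cancel_right]⟩

/-- A lift to the twisted wreath product is determined by its restriction and its values at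
representatives of the elements of `Q`, provided that no nontrivial element of the kernel
centralizes the commutator subgroup and a system of representatives of `Q`. -/
theorem eq_of_restrict_eq (hT : commutator P ≤ T) {u : Q → P} (hu : ∀ σ, ψ₀ (u σ) = σ)
    (hZ : ∀ e ∈ K, (∀ φ ∈ K, ∀ τ, Commute e (φ * (leftTranslate Q Γ τ φ)⁻¹)) →
      (∀ τ, ∃ φ ∈ K, e * φ = φ * leftTranslate Q Γ τ e) → e = 1)
    {ψ₁ ψ₂ : P →* wreathOf K h.translate_mem} (h₁ : h.proj.comp ψ₁ = ψ₀)
    (h₂ : h.proj.comp ψ₂ = ψ₀) (hψs : Function.Surjective ψ₁)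
    (hr : h.restrict ψ₁ h₁ = h.restrict ψ₂ h₂) (huv : ∀ σ, ψ₁ (u σ) = ψ₂ (u σ)) : ψ₁ = ψ₂ := by
  have hcomm : ∀ x y : P, ⁅x, y⁆ ∈ T := fun x y =>
    hT (Subgroup.commutator_mem_commutator (Subgroup.mem_top _) (Subgroup.mem_top _))
  have hTn : ∀ t ∈ T, ∀ x : P, x * t * x⁻¹ ∈ T := fun t ht x => by
    have := T.mul_mem (hcomm x t) ht
    rwa [commutatorElement_def, inv_mul_cancel_right] at this
  have heq : ∀ t ∈ T, ψ₁ t = ψ₂ t := by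
    intro t ht
    refine Subtype.ext (SemidirectProduct.ext (funext fun σ => ?_) ?_)
    -- Conjugating by a representative of `σ⁻¹` carries the coordinate at `σ` to the coordinate at
    -- `1`, which the restriction records.
    · have h3 := DFunLike.congr_fun hr ⟨_, hTn t ht (u σ⁻¹)⟩
      simp only [restrict_apply, mul_left_inj, map_mul, Subgroup.coe_mul,
        SemidirectProduct.mul_left, SemidirectProduct.mul_right, Pi.mul_apply, map_inv ψ₁, map_inv ψ₂,
        huv σ⁻¹, leftTranslate_apply, h.right_apply h₁, h.right_apply h₂, mul_right_inj, hu] at h3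
      simpa only [mul_left_inj, mul_right_inj, inv_inv, mul_one] using h3
    · rw [h.right_apply h₁, h.right_apply h₂]
  ext1 x
  -- Since `⁅x, y⁆` lies in `T`, both lifts agree on it, so `ψ₁ x` and `ψ₂ x` conjugate `ψ₁ y`
  -- alike.
  have hc : ∀ y : P, ψ₁ y = ψ₂ y → Commute ((ψ₁ x)⁻¹ * ψ₂ x) (ψ₁ y) := by
    intro y hy
    have h3 := heq _ (hcomm x⁻¹ y)
    simp only [commutatorElement_def, map_mul, map_inv, ← hy, inv_inv, mul_left_inj] at h3
    have h4 : ψ₁ x * ψ₁ y * (ψ₁ x)⁻¹ = ψ₂ x * ψ₁ y * (ψ₂ x)⁻¹ := by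
      have h5 := heq _ (hcomm x y)
      simpa only [commutatorElement_def, map_mul, map_inv, ← hy, mul_left_inj] using h5
    have h6 : ψ₂ x * ψ₁ y = ψ₁ x * ψ₁ y * (ψ₁ x)⁻¹ * ψ₂ x := by rw [h4, inv_mul_cancel_right]
    show (ψ₁ x)⁻¹ * ψ₂ x * ψ₁ y = ψ₁ y * ((ψ₁ x)⁻¹ * ψ₂ x)
    rw [mul_assoc, h6]
    group
  obtain ⟨w, hw⟩ : ∃ w, w = (ψ₁ x)⁻¹ * ψ₂ x := ⟨_, rfl⟩
  rw [← hw] at hc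
  have hwr : w.1.right = 1 := by
    simp [hw, h.right_apply h₁, h.right_apply h₂]
  have hwe : w.1 = SemidirectProduct.inl w.1.left := SemidirectProduct.ext rfl hwr
  have hleft : w.1.left = 1 := by
    -- The two conditions come from `hc` applied to commutators in `T` and to the representatives `u
    -- τ`.
    refine hZ _ w.2 (fun φ hφ τ => ?_) fun τ => ⟨_, (ψ₁ (u τ)).2, ?_⟩
    · obtain ⟨a, ha⟩ := hψs (h.fiber φ hφ)
      obtain ⟨b, hb⟩ := hψs (h.sect τ)
      have hψab : (ψ₁ ⁅a, b⁆).1 = SemidirectProduct.inl (φ * (leftTranslate Q Γ τ φ)⁻¹) := by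
        rw [map_commutatorElement, ha, hb, coe_commutator_fiber_sect]
      have h3 := congrArg Subtype.val (hc _ (heq _ (hcomm a b))).eq
      rw [Subgroup.coe_mul, Subgroup.coe_mul, hψab, hwe, ← map_mul, ← map_mul] at h3
      exact SemidirectProduct.inl_injective h3
    · have h3 := congrArg (fun v => v.1.left) (hc _ (huv τ)).eq
      simpa only [Subgroup.coe_mul, SemidirectProduct.mul_left, hwr, map_one, MulAut.one_apply,
        h.right_apply h₁, hu] using h3
  have : w = 1 := Subtype.ext (SemidirectProduct.ext hleft hwr)
  exact inv_mul_eq_one.1 (hw.symm.trans this)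

end IsTwisted

namespace IsTwisted

variable {P : Type u} {Q G Γ : Type} [Group P] [Group Q] [Group G] [Group Γ] {T : Subgroup P}
  {ψ₀ : P →* Q} {α : T →* G} {f : Γ →* G} {s : G →* Γ} {K : Subgroup (Q → Γ)}
  [TopologicalSpace P] [IsTopologicalGroup P] {m : Cardinal.{u}}

/-- Restriction of solutions of the embedding problem given by the twisted wreath product. -/
def restrictSolution (h : IsTwisted ψ₀ α f s K) (hT : commutator P ≤ T)
    (hs : f.comp s = MonoidHom.id G) (hαo : IsOpen (α.ker : Set T))
    (hα : Function.Surjective α) (hker : ∀ t : T, ψ₀ t = 1 → α t = 1)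
    (hK : ∀ n ∈ f.ker, ∃ φ ∈ K, ∃ τ, φ 1 * (φ τ⁻¹)⁻¹ = n) (ψ : OpenSolution ψ₀ h.proj) :
    OpenSolution α f :=
  ⟨h.restrict ψ.1 ψ.2.2.1, h.isOpen_ker_restrict hαo _ _ ψ.2.1, h.comp_restrict hs _ _,
    h.surjective_restrict hT hs hα hker hK _ _ ψ.2.2.2⟩

theorem mk_openSolution_proj [Finite Q] [Finite Γ] (h : IsTwisted ψ₀ α f s K)
    (hP : IsQuasiFreeOfRank P m) (hψo : IsOpen (ψ₀.ker : Set P)) (hψ₀ : Function.Surjective ψ₀)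
    (hf : f.ker ≠ ⊥) (hK : ∀ n ∈ f.ker, ∃ φ ∈ K, ∃ τ, φ 1 * (φ τ⁻¹)⁻¹ = n) :
    Cardinal.mk (OpenSolution ψ₀ h.proj) = m := by
  obtain ⟨⟨n, hn⟩, hn1⟩ := Subgroup.ne_bot_iff_exists_ne_one.1 hf
  obtain ⟨φ, hφ, τ, hφn⟩ := hK n hn
  refine isQuasiFreeOfRank_iff.1 hP _ _ ψ₀ h.proj h.sect hψo hψ₀ h.proj_comp_sect
    (h.ker_proj_ne_bot hφ ?_)
  rintro rfl
  exact hn1 (Subtype.ext (by simpa using hφn.symm))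

/-- The `m` solutions for `P` inject into pairs of a solution for `T` and one of finitely many value
tables on representatives of `Q`. As `m` is infinite, the first factor has at least `m` elements. -/
theorem le_mk_openSolution [Finite Q] [Finite Γ] (h : IsTwisted ψ₀ α f s K)
    (hm : Cardinal.aleph0 ≤ m) (hP : IsQuasiFreeOfRank P m) (hψo : IsOpen (ψ₀.ker : Set P))
    (hψ₀ : Function.Surjective ψ₀) (hf : f.ker ≠ ⊥) (hT : commutator P ≤ T)
    (hs : f.comp s = MonoidHom.id G) (hαo : IsOpen (α.ker : Set T))
    (hα : Function.Surjective α) (hker : ∀ t : T, ψ₀ t = 1 → α t = 1)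
    (hK : ∀ n ∈ f.ker, ∃ φ ∈ K, ∃ τ, φ 1 * (φ τ⁻¹)⁻¹ = n)
    (hZ : ∀ e ∈ K, (∀ φ ∈ K, ∀ τ, Commute e (φ * (leftTranslate Q Γ τ φ)⁻¹)) →
      (∀ τ, ∃ φ ∈ K, e * φ = φ * leftTranslate Q Γ τ e) → e = 1) :
    m ≤ Cardinal.mk (OpenSolution α f) := by
  choose u hu using hψ₀
  let F : OpenSolution ψ₀ h.proj → OpenSolution α f × (Q → wreathOf K h.translate_mem) :=
    fun ψ => ⟨h.restrictSolution hT hs hαo hα hker hK ψ, fun σ => ψ.1 (u σ)⟩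
  have hF : Function.Injective F := fun a b hab => Subtype.ext <|
    h.eq_of_restrict_eq hT hu hZ a.2.2.1 b.2.2.1 a.2.2.2
      (congrArg Subtype.val (congrArg Prod.fst hab)) (congrFun (congrArg Prod.snd hab))
  have h1 := Cardinal.mk_le_of_injective hF
  rw [h.mk_openSolution_proj hP hψo (fun σ => ⟨u σ, hu σ⟩) hf hK, Cardinal.mk_prod] at h1
  by_contra! hlt
  refine h1.not_gt (Cardinal.mul_lt_of_lt hm (by simpa using hlt) ?_)
  exact (Cardinal.lift_lt_aleph0.2 (Cardinal.lt_aleph0_of_finite _)).trans_le hm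

end IsTwisted

/-! ### Twisted functions with a cyclic factor of order six -/

/-- The full group of twisted functions. -/
def twistedFunctions {P : Type u} {Q G Γ : Type} [Group P] [Group Q] [Group G] [Group Γ]
    {T : Subgroup P} (ψ₀ : P →* Q) (α : T →* G) (f : Γ →* G) (s : G →* Γ) :
    Subgroup (Q → Γ) where
  carrier := {φ | (∀ σ, f (φ σ) = 1) ∧
    ∀ (σ : Q) (t : T), φ (σ * ψ₀ t) = (s (α t))⁻¹ * φ σ * s (α t)}
  mul_mem' {a b} ha hb := by
    refine ⟨fun σ => by simp [ha.1, hb.1], fun σ t => ?_⟩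
    simp only [Pi.mul_apply, ha.2, hb.2]
    group
  one_mem' := by simp
  inv_mem' {a} ha := by
    refine ⟨fun σ => by simp [ha.1], fun σ t => ?_⟩
    simp only [Pi.inv_apply, ha.2]
    group

theorem isTwisted_twistedFunctions {P : Type u} {Q G Γ : Type} [Group P] [Group Q] [Group G]
    [Group Γ] {T : Subgroup P} (ψ₀ : P →* Q) (α : T →* G) (f : Γ →* G) (s : G →* Γ) :
    IsTwisted ψ₀ α f s (twistedFunctions ψ₀ α f s) where
  translate_mem τ φ hφ :=
    ⟨fun σ => hφ.1 _, fun σ t => by simp only [leftTranslate_apply, ← mul_assoc, hφ.2]⟩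
  map_eq_one φ hφ := hφ.1
  apply_mul φ hφ := hφ.2

section Cyclic

variable {P : Type u} {R G Γ : Type} [Group P] [Group R] [Group G] [Group Γ] {T : Subgroup P}
  {ψ₀ : P →* R × Multiplicative (ZMod 6)} {α : T →* G} {f : Γ →* G} {s : G →* Γ}

open Classical in
/-- The twisted function supported on the image of `T` with prescribed values `w` on the cyclic
factor. -/
noncomputable def bump (ψ₀ : P →* R × Multiplicative (ZMod 6)) (α : T →* G) (s : G →* Γ)
    (w : Multiplicative (ZMod 6) → Γ) (σ : R × Multiplicative (ZMod 6)) : Γ :=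
  if h : ∃ t : T, (ψ₀ t).1 = σ.1 then (s (α h.choose))⁻¹ * w σ.2 * s (α h.choose) else 1

theorem bump_apply (hker : ∀ t : T, (ψ₀ t).1 = 1 → α t = 1) (w : Multiplicative (ZMod 6) → Γ)
    (t : T) (c : Multiplicative (ZMod 6)) :
    bump ψ₀ α s w ((ψ₀ t).1, c) = (s (α t))⁻¹ * w c * s (α t) := by
  have h : ∃ t' : T, (ψ₀ t').1 = (ψ₀ t).1 := ⟨t, rfl⟩
  have h1 : α h.choose = α t := by
    rw [← mul_inv_eq_one, ← map_inv, ← map_mul]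
    apply hker
    simp [h.choose_spec]
  rw [bump, dif_pos h, h1]

theorem bump_one (hker : ∀ t : T, (ψ₀ t).1 = 1 → α t = 1) (w : Multiplicative (ZMod 6) → Γ)
    (c : Multiplicative (ZMod 6)) : bump ψ₀ α s w (1, c) = w c := by
  simpa using bump_apply (s := s) hker w 1 c

theorem bump_mem (hker : ∀ t : T, (ψ₀ t).1 = 1 → α t = 1) (hψT : ∀ t : T, (ψ₀ t).2 = 1)
    {w : Multiplicative (ZMod 6) → Γ} (hw : ∀ c, f (w c) = 1) :
    bump ψ₀ α s w ∈ twistedFunctions ψ₀ α f s := by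
  refine ⟨fun σ => ?_, fun σ t => ?_⟩
  · rw [bump]
    split_ifs with h
    · simp [hw]
    · exact map_one f
  · by_cases h : ∃ t' : T, (ψ₀ t').1 = σ.1
    · obtain ⟨t', ht'⟩ := h
      obtain ⟨r, c⟩ := σ
      obtain rfl : (ψ₀ t').1 = r := ht'
      have h1 : ((ψ₀ t').1, c) * ψ₀ t = ((ψ₀ (t' * t : T)).1, c) :=
        Prod.ext (by simp) (by simp [hψT])
      rw [h1, bump_apply hker, bump_apply hker, map_mul, map_mul]
      group
    · have h2 : ¬ ∃ t' : T, (ψ₀ t').1 = (σ * ψ₀ t).1 := by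
        rintro ⟨t', ht'⟩
        exact h ⟨t' * t⁻¹, by simp [ht']⟩
      rw [bump, bump, dif_neg h, dif_neg h2]
      group

/-- Because `T` has trivial image in the cyclic factor, equivariance does not relate the values at
`1` and at `(1, g)`. -/
theorem twistedFunctions_values (hker : ∀ t : T, (ψ₀ t).1 = 1 → α t = 1)
    (hψT : ∀ t : T, (ψ₀ t).2 = 1) (n : Γ) (hn : n ∈ f.ker) :
    ∃ φ ∈ twistedFunctions ψ₀ α f s, φ 1 = n ∧ φ (1, Multiplicative.ofAdd 1) = 1 := by
  classical
  refine ⟨_, bump_mem hker hψT (w := fun c => if c = 1 then n else 1) fun c => ?_, ?_, ?_⟩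
  · split_ifs
    · exact hn
    · exact map_one f
  · exact (bump_one hker _ 1).trans (if_pos rfl)
  · exact (bump_one hker _ _).trans (if_neg (by decide))

theorem twistedFunctions_surj (hker : ∀ t : T, (ψ₀ t).1 = 1 → α t = 1)
    (hψT : ∀ t : T, (ψ₀ t).2 = 1) (n : Γ) (hn : n ∈ f.ker) :
    ∃ φ ∈ twistedFunctions ψ₀ α f s, ∃ τ, φ 1 * (φ τ⁻¹)⁻¹ = n := by
  obtain ⟨φ, hφ, h1, h2⟩ := twistedFunctions_values (s := s) hker hψT n hn
  exact ⟨φ, hφ, (1, Multiplicative.ofAdd 1)⁻¹, by rw [inv_inv, h1, h2, inv_one, mul_one]⟩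

theorem twistedFunctions_centralizer (hker : ∀ t : T, (ψ₀ t).1 = 1 → α t = 1)
    (hψT : ∀ t : T, (ψ₀ t).2 = 1) (hc : ∀ z ∈ f.ker, (∀ n ∈ f.ker, Commute z n) → z = 1)
    (e : R × Multiplicative (ZMod 6) → Γ) (he : e ∈ twistedFunctions ψ₀ α f s)
    (h : ∀ φ ∈ twistedFunctions ψ₀ α f s, ∀ τ, Commute e (φ * (leftTranslate _ Γ τ φ)⁻¹)) :
    e = 1 := by
  funext σ
  refine hc _ (he.1 σ) fun n hn => ?_
  obtain ⟨φ, hφ, h1, h2⟩ := twistedFunctions_values (s := s) hker hψT n hn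
  -- Translating `φ` by `σ` puts the value `n` at `σ`; since the cyclic factor is central, the
  -- further shift reads the value of `φ` at `(1, g)`, which is `1`. Thus `e σ` commutes with `n`.
  have h3 := congrFun (h _ ((isTwisted_twistedFunctions ψ₀ α f s).translate_mem σ φ hφ)
    (1, Multiplicative.ofAdd 1)⁻¹).eq σ
  have h4 : σ⁻¹ * ((1, Multiplicative.ofAdd 1) * σ) = (1, Multiplicative.ofAdd 1) :=
    Prod.ext (by simp) (by simp [mul_comm])
  show e σ * n = n * e σ
  simpa only [Pi.mul_apply, Pi.inv_apply, leftTranslate_apply, inv_inv, h4, h1, h2,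
    inv_mul_cancel, inv_one, mul_one] using h3

/-- For a commutative kernel, the twisted functions on which a generator `g` of the cyclic factor
satisfies `g² - g + 1 = 0`, so that `1 - g` is invertible. -/
def cyclotomicFunctions (ψ₀ : P →* R × Multiplicative (ZMod 6)) (α : T →* G) (f : Γ →* G)
    (s : G →* Γ) (hf : ∀ a ∈ f.ker, ∀ b ∈ f.ker, Commute a b) :
    Subgroup (R × Multiplicative (ZMod 6) → Γ) where
  carrier := {φ | φ ∈ twistedFunctions ψ₀ α f s ∧ ∀ r c,
    φ (r, c) * φ (r, c * Multiplicative.ofAdd 2) = φ (r, c * Multiplicative.ofAdd 1)}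
  mul_mem' {a b} ha hb := by
    refine ⟨mul_mem ha.1 hb.1, fun r c => ?_⟩
    simp only [Pi.mul_apply]
    rw [← ha.2, ← hb.2, (hf _ (hb.1.1 _) _ (ha.1.1 _)).mul_mul_mul_comm]
  one_mem' := ⟨one_mem _, by simp⟩
  inv_mem' {a} ha := by
    refine ⟨inv_mem ha.1, fun r c => ?_⟩
    simp only [Pi.inv_apply]
    rw [← ha.2, mul_inv_rev, (hf _ (ha.1.1 _) _ (ha.1.1 _)).inv_inv.eq]

theorem isTwisted_cyclotomicFunctions (ψ₀ : P →* R × Multiplicative (ZMod 6)) (α : T →* G)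
    (f : Γ →* G) (s : G →* Γ) (hf : ∀ a ∈ f.ker, ∀ b ∈ f.ker, Commute a b) :
    IsTwisted ψ₀ α f s (cyclotomicFunctions ψ₀ α f s hf) where
  translate_mem τ φ hφ := by
    refine ⟨(isTwisted_twistedFunctions ψ₀ α f s).translate_mem τ φ hφ.1, fun r c => ?_⟩
    have := hφ.2 (τ.1⁻¹ * r) (τ.2⁻¹ * c)
    rwa [mul_assoc, mul_assoc] at this
  map_eq_one φ hφ := hφ.1.1
  apply_mul φ hφ := hφ.1.2

/-- The values of the sequence `a (i + 2) = a (i + 1) - a i`, which has period six. -/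
def sexticSequence : ZMod 6 → ℤ := ![0, -1, -1, 0, 1, 1]

theorem sexticSequence_add (c : ZMod 6) :
    sexticSequence c + sexticSequence (c + 2) = sexticSequence (c + 1) := by
  revert c
  decide

/-- The witness takes powers of `n` along `sexticSequence`; its first two terms, `0` and `-1`,
differ by `1`, which yields `n` itself. -/
theorem cyclotomicFunctions_surj (hf : ∀ a ∈ f.ker, ∀ b ∈ f.ker, Commute a b)
    (hker : ∀ t : T, (ψ₀ t).1 = 1 → α t = 1) (hψT : ∀ t : T, (ψ₀ t).2 = 1) (n : Γ)
    (hn : n ∈ f.ker) :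
    ∃ φ ∈ cyclotomicFunctions ψ₀ α f s hf, ∃ τ, φ 1 * (φ τ⁻¹)⁻¹ = n := by
  let w : Multiplicative (ZMod 6) → Γ := fun c => n ^ sexticSequence c.toAdd
  have hn' : f n = 1 := hn
  refine ⟨bump ψ₀ α s w, ⟨bump_mem hker hψT fun c => by simp [w, hn'], fun r c => ?_⟩,
    (1, Multiplicative.ofAdd 1)⁻¹, ?_⟩
  · by_cases h : ∃ t : T, (ψ₀ t).1 = r
    · obtain ⟨t, rfl⟩ := h
      have hw : w (c * Multiplicative.ofAdd 1) = w c * w (c * Multiplicative.ofAdd 2) := by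
        simp only [w, ← zpow_add, toAdd_mul, toAdd_ofAdd, sexticSequence_add]
      rw [bump_apply hker, bump_apply hker, bump_apply hker, hw]
      group
    · rw [bump, bump, bump, dif_neg h, dif_neg h, dif_neg h, mul_one]
  · rw [inv_inv, ← Prod.mk_one_one, bump_one hker, bump_one hker]
    simp [w, sexticSequence]

/-- Commutativity reduces the relation to invariance of `e` under `g`; the cyclotomic relation then
reads `e * e = e`. -/
theorem cyclotomicFunctions_centralizer (hf : ∀ a ∈ f.ker, ∀ b ∈ f.ker, Commute a b)
    (e : R × Multiplicative (ZMod 6) → Γ) (he : e ∈ cyclotomicFunctions ψ₀ α f s hf)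
    (h : ∀ τ, ∃ φ ∈ cyclotomicFunctions ψ₀ α f s hf, e * φ = φ * leftTranslate _ Γ τ e) :
    e = 1 := by
  obtain ⟨φ, hφ, h1⟩ := h (1, Multiplicative.ofAdd 1)⁻¹
  have h2 : ∀ r c, e (r, c * Multiplicative.ofAdd 1) = e (r, c) := by
    intro r c
    have h3 := congrFun h1 (r, c)
    rw [Pi.mul_apply, (hf _ (he.1.1 _) _ (hφ.1.1 _)).eq, Pi.mul_apply, mul_right_inj,
      leftTranslate_apply, inv_inv, Prod.mk_mul_mk, one_mul, mul_comm] at h3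
    exact h3.symm
  funext ⟨r, c⟩
  have h4 := he.2 r c
  have h5 : c * Multiplicative.ofAdd 2 =
      c * Multiplicative.ofAdd 1 * Multiplicative.ofAdd (1 : ZMod 6) := by
    rw [mul_assoc, ← ofAdd_add, one_add_one_eq_two]
  rw [h5, h2, h2] at h4
  simpa using h4

end Cyclic

/-! ### The lower bound -/

/-- A homomorphism with open kernel on the closed commutator subgroup of a quasi-free group is
dominated by a finite quotient of the group with an additional cyclic factor of order six. -/
theorem exists_quotient_prod_cyclic {m : Cardinal.{u}} (hm : Cardinal.aleph0 ≤ m)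
    {P : Type u} [Group P] [TopologicalSpace P] [IsTopologicalGroup P]
    [CompactSpace P] [TotallyDisconnectedSpace P] (hP : IsQuasiFreeOfRank P m)
    {G : Type} [Group G] (α : (commutator P).topologicalClosure →* G)
    (hα : IsOpen (α.ker : Set (commutator P).topologicalClosure)) :
    ∃ (R : Type) (_ : Group R) (_ : Finite R) (ψ₀ : P →* R × Multiplicative (ZMod 6)),
      IsOpen (ψ₀.ker : Set P) ∧ Function.Surjective ψ₀ ∧
      (∀ t : (commutator P).topologicalClosure, (ψ₀ t).1 = 1 → α t = 1) ∧
      ∀ t : (commutator P).topologicalClosure, (ψ₀ t).2 = 1 := by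
  obtain ⟨n, θ, hθ, hθα⟩ := exists_perm_hom_ker_le _ α hα
  -- The direct product with the cyclic group is itself a split embedding problem, so `θ` lifts to
  -- an epimorphism onto it.
  have hmk := isQuasiFreeOfRank_iff.1 hP θ.range (θ.range × Multiplicative (ZMod 6))
    θ.rangeRestrict (MonoidHom.fst _ _) (MonoidHom.inl _ _)
    (by rwa [MonoidHom.ker_rangeRestrict]) θ.rangeRestrict_surjective rfl (fun h => by
      have h1 : ((1, Multiplicative.ofAdd 1) : θ.range × Multiplicative (ZMod 6)) ∈
        (MonoidHom.fst θ.range (Multiplicative (ZMod 6))).ker := rfl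
      rw [h, Subgroup.mem_bot, Prod.ext_iff] at h1
      exact absurd h1.2 (show Multiplicative.ofAdd (1 : ZMod 6) ≠ 1 by decide))
  have hne : Cardinal.mk (OpenSolution θ.rangeRestrict
      (MonoidHom.fst θ.range (Multiplicative (ZMod 6)))) ≠ 0 := by
    rw [hmk]
    exact (Cardinal.aleph0_pos.trans_le hm).ne'
  obtain ⟨ψ₀, hψo, hψθ, hψs⟩ := (Cardinal.mk_ne_zero_iff.1 hne).some
  refine ⟨θ.range, inferInstance, inferInstance, ψ₀, hψo, hψs, fun t ht => hθα t ?_, fun t => ?_⟩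
  · have h1 := DFunLike.congr_fun hψθ (t : P)
    exact congrArg Subtype.val (h1.symm.trans ht)
  · let χ := (MonoidHom.snd θ.range (Multiplicative (ZMod 6))).comp ψ₀
    have hχo : IsOpen (χ.ker : Set P) := Subgroup.isOpen_mono
      (fun x hx => by
        have hx' : ψ₀ x = 1 := hx
        show (ψ₀ x).2 = 1
        rw [hx', Prod.snd_one]) hψo
    have hχ : (commutator P).topologicalClosure ≤ χ.ker :=
      Subgroup.topologicalClosure_minimal _ (Abelianization.commutator_subset_ker χ)
        (Subgroup.isClosed_of_isOpen _ hχo)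
    exact hχ t.2

section LowerBound

variable {m : Cardinal.{u}} (hm : Cardinal.aleph0 ≤ m)
  {P : Type u} [Group P] [TopologicalSpace P] [IsTopologicalGroup P]
  [CompactSpace P] [TotallyDisconnectedSpace P] (hP : IsQuasiFreeOfRank P m)
  {G Γ : Type} [Group G] [Group Γ] [Finite Γ] {α : (commutator P).topologicalClosure →* G}
  {f : Γ →* G} {s : G →* Γ} (hαo : IsOpen (α.ker : Set (commutator P).topologicalClosure))
  (hα : Function.Surjective α) (hs : f.comp s = MonoidHom.id G) (hf : f.ker ≠ ⊥)

include hm hP hαo hα hs hf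

/-- Existence needs only surjectivity of the restricted map, so it holds without any condition on
the center of `ker f`. -/
theorem nonempty_openSolution : Nonempty (OpenSolution α f) := by
  obtain ⟨R, _, _, ψ₀, hψo, hψs, hker, hψT⟩ := exists_quotient_prod_cyclic hm hP α hαo
  have h := isTwisted_twistedFunctions ψ₀ α f s
  have hmk := h.mk_openSolution_proj hP hψo hψs hf (twistedFunctions_surj hker hψT)
  have hne : Cardinal.mk (OpenSolution ψ₀ h.proj) ≠ 0 := by
    rw [hmk]
    exact (Cardinal.aleph0_pos.trans_le hm).ne'
  exact (Cardinal.mk_ne_zero_iff.1 hne).map (h.restrictSolution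
    (Subgroup.le_topologicalClosure _) hs hαo hα (fun t ht => hker t (by rw [ht, Prod.fst_one]))
    (twistedFunctions_surj hker hψT))

theorem le_mk_openSolution_of_centerless
    (hc : ∀ z ∈ f.ker, (∀ n ∈ f.ker, Commute z n) → z = 1) :
    m ≤ Cardinal.mk (OpenSolution α f) := by
  obtain ⟨R, _, _, ψ₀, hψo, hψs, hker, hψT⟩ := exists_quotient_prod_cyclic hm hP α hαo
  exact (isTwisted_twistedFunctions ψ₀ α f s).le_mk_openSolution hm hP hψo hψs hf
    (Subgroup.le_topologicalClosure _) hs hαo hα (fun t ht => hker t (by rw [ht, Prod.fst_one]))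
    (twistedFunctions_surj hker hψT)
    fun e he h1 _ => twistedFunctions_centralizer hker hψT hc e he h1

theorem le_mk_openSolution_of_commutative (hc : ∀ a ∈ f.ker, ∀ b ∈ f.ker, Commute a b) :
    m ≤ Cardinal.mk (OpenSolution α f) := by
  obtain ⟨R, _, _, ψ₀, hψo, hψs, hker, hψT⟩ := exists_quotient_prod_cyclic hm hP α hαo
  exact (isTwisted_cyclotomicFunctions ψ₀ α f s hc).le_mk_openSolution hm hP hψo hψs hf
    (Subgroup.le_topologicalClosure _) hs hαo hα (fun t ht => hker t (by rw [ht, Prod.fst_one]))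
    (cyclotomicFunctions_surj hc hker hψT)
    fun e he _ h2 => cyclotomicFunctions_centralizer hc e he h2

/-- If the kernel has a nontrivial center, one solution is twisted by the solutions of the
embedding problem with the center as kernel. -/
theorem le_mk_openSolution_commutator : m ≤ Cardinal.mk (OpenSolution α f) := by
  by_cases hc : ∀ z ∈ f.ker, (∀ n ∈ f.ker, Commute z n) → z = 1
  · exact le_mk_openSolution_of_centerless hm hP hαo hα hs hf hc
  push Not at hc
  obtain ⟨z, hz, hzc, hz1⟩ := hc
  obtain ⟨β, hβo, hβα, hβs⟩ := nonempty_openSolution hm hP hαo hα hs hf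
  let Z : Subgroup Γ := f.ker ⊓ Subgroup.centralizer f.ker
  have hzZ : z ∈ Z := ⟨hz, Subgroup.mem_centralizer_iff.2 fun n hn => (hzc n hn).eq.symm⟩
  let E := Z ⋊[MulAut.conjNormal] Γ
  have : Finite E := Finite.of_equiv _ SemidirectProduct.equivProd.symm
  let p : E →* Γ := SemidirectProduct.rightHom
  -- Multiplication `(z, g) ↦ z * g` is a homomorphism for the conjugation action. As `Z` lies in
  -- `ker f`, it has the same image in `G` as the projection `p`, so composing with it sends
  -- solutions over `β` to solutions over `α`.
  let μ : E →* Γ := SemidirectProduct.lift Z.subtype (MonoidHom.id Γ) fun g => by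
    ext x
    simp [MulAut.conjNormal_apply]
  have hμ : ∀ e : E, μ e = e.left * e.right := fun e => rfl
  have hpker : ∀ e ∈ p.ker, e = SemidirectProduct.inl e.left := fun e he =>
    SemidirectProduct.ext rfl he
  have hp : p.ker ≠ ⊥ := by
    intro hb
    have h1 : (SemidirectProduct.inl ⟨z, hzZ⟩ : E) ∈ p.ker := rfl
    rw [hb, Subgroup.mem_bot] at h1
    exact hz1 (congrArg (fun e : E => (e.left : Γ)) h1)
  have hle := le_mk_openSolution_of_commutative hm hP (α := β) (f := p)
    (s := SemidirectProduct.inr) hβo hβs rfl hp fun a ha b hb => by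
      rw [hpker a ha, hpker b hb]
      refine Commute.map (Subtype.ext ?_) SemidirectProduct.inl
      exact Subgroup.mem_centralizer_iff.1 b.left.2.2 _ a.left.2.1
  refine hle.trans (Cardinal.mk_le_of_injective (f := fun γ : OpenSolution β p =>
    (⟨μ.comp γ.1, ?_, ?_, ?_⟩ : OpenSolution α f)) ?_)
  · refine Subgroup.isOpen_mono (fun x hx => ?_) γ.2.1
    have hx' : γ.1 x = 1 := hx
    show μ (γ.1 x) = 1
    rw [hx', map_one]
  · ext t
    have h1 : f (γ.1 t).left = 1 := (γ.1 t).left.2.1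
    have h2 : (γ.1 t).right = β t := DFunLike.congr_fun γ.2.2.1 t
    show f (μ (γ.1 t)) = α t
    rw [hμ, map_mul, h1, one_mul, h2]
    exact DFunLike.congr_fun hβα t
  · have hμs : Function.Surjective μ := fun g =>
      ⟨SemidirectProduct.inr g, by rw [hμ]; simp⟩
    exact hμs.comp γ.2.2.2
  -- The right component is always `β t`, so the product determines the central component.
  · intro γ δ hγδ
    refine Subtype.ext (MonoidHom.ext fun t => ?_)
    have h1 : μ (γ.1 t) = μ (δ.1 t) := DFunLike.congr_fun (congrArg Subtype.val hγδ) t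
    have h2 : (γ.1 t).right = (δ.1 t).right :=
      (DFunLike.congr_fun γ.2.2.1 t).trans (DFunLike.congr_fun δ.2.2.1 t).symm
    rw [hμ, hμ, h2, mul_left_inj] at h1
    exact SemidirectProduct.ext (Subtype.ext h1) h2

end LowerBound

theorem theorem2p4 (m : Cardinal.{u}) (hm : Cardinal.aleph0 ≤ m)
    (P : Type u) [Group P] [TopologicalSpace P] [IsTopologicalGroup P]
    [CompactSpace P] [TotallyDisconnectedSpace P]
    (hP : IsQuasiFreeOfRank P m) :
    IsQuasiFreeOfRank (commutator P).topologicalClosure m :=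
  isQuasiFreeOfRank_iff.2 fun _ _ _ _ _ α f _ hαo hα hs hf =>
    le_antisymm (mk_openSolution_le hm hP _ α f)
      (le_mk_openSolution_commutator hm hP hαo hα hs hf)
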